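/- For $p\in\mathbb C[z_1,z_2]$ of bidegree $(n_1,n_2)$ (so $n_j=\deg_{z_j}p$) let $\tilde p(z)=z_1^{n_1}z_2^{n_2}\,\overline{p(1/\bar z_1,1/\bar z_2)}$. Let $\phi=c\,\tilde p/p$ be a rational inner function on the bidisk $\mathbb D^2$ of bidegree $(n_1,1)$: $|c|=1$, $p$ has bidegree $(n_1,1)$ and no zeros in $\mathbb D^2$, and $p,\tilde p$ have no common factor. A singularity of a rational function on $\mathbb D^2$ (with denominator zero-free in $\mathbb D^2$) is a point of $\mathbb T^2$ at which the numerator and the denominator of its reduced form both vanish. If the function has degree $1$ in $z_2$, its $z_2$-contact order at a singularity $(e^{i\eta_1},e^{i\eta_2})$ is the number $m$ with $1-|\psi^0(e^{i\theta})|^2\asymp|\theta-\eta_1|^{m}$ as $\theta\to\eta_1$, where $\psi^0(e^{i\theta})$ is the unique zero in $z_2$ of the numerator of the reduced form on the line $z_1=e^{i\theta}$. Let $N\ge 1$ and let $\phi^N$ be the $N$-fold composition of $\phi$ in the second variable: $\phi^1=\phi$ and $\phi^{k+1}(z_1,z_2)=\phi(z_1,\phi^k(z_1,z_2))$ for $z\in\mathbb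 D^2$. Suppose $\phi$ has exactly $s$ singularities $\zeta^1,\dots,\zeta^s\in\mathbb T^2$, with contact orders $2K_1,\dots,2K_s$, and suppose $\phi^N$ has full bidegree, that is, after cancellation of common factors it has bidegree $(Nn_1,1)$ (the degree in each variable being the maximum of those of numerator and denominator). Then $\phi^N$ has exactly $s$ singularities, at the same points $\zeta^1,\dots,\zeta^s$, and its contact order at $\zeta^j$ is $2NK_j$ for $j=1,\dots,s$. -/

import Mathlib

open scoped ComplexConjugate
open Filter Topology Asymptotics

noncomputable section

namespace BidiskRIF

/-- The open unit bidisk; the coordinates `z 0`, `z 1` stand for `z₁`, `z₂`. -/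
def bidisk : Set (Fin 2 → ℂ) := {z | ∀ j, ‖z j‖ < 1}

/-- The distinguished boundary of the bidisk. -/
def torus : Set (Fin 2 → ℂ) := {z | ∀ j, ‖z j‖ = 1}

/-- The reflection `z₁ ^ n₁ * z₂ ^ n₂ * conj (p (1 / conj z₁, 1 / conj z₂))` of a polynomial `p`,
where `nⱼ` is the degree of `p` in `zⱼ`. -/
def reflection (p : MvPolynomial (Fin 2) ℂ) : MvPolynomial (Fin 2) ℂ :=
  ∑ m ∈ p.support, MvPolynomial.monomial
    (Finsupp.equivFunOnFinite.symm fun j => p.degreeOf j - m j) (conj (p.coeff m))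

theorem eval_reflection (p : MvPolynomial (Fin 2) ℂ) (z : Fin 2 → ℂ) (hz : ∀ j, z j ≠ 0) :
    MvPolynomial.eval z (reflection p) =
      z 0 ^ p.degreeOf 0 * z 1 ^ p.degreeOf 1 *
        conj (MvPolynomial.eval (fun j => 1 / conj (z j)) p) := by
  rw [MvPolynomial.eval_eq' (fun j => 1 / conj (z j)) p, reflection, map_sum, map_sum,
    Finset.mul_sum]
  refine Finset.sum_congr rfl fun m hm => ?_
  have h : ∀ j, m j ≤ p.degreeOf j := fun j => MvPolynomial.monomial_le_degreeOf j hm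
  rw [MvPolynomial.eval_monomial, Finsupp.prod_fintype _ _ (by simp)]
  simp only [Fin.prod_univ_two, Finsupp.equivFunOnFinite_symm_apply_apply, map_mul, map_pow,
    map_div₀, map_one, Complex.conj_conj]
  rw [pow_sub₀ _ (hz 0) (h 0), pow_sub₀ _ (hz 1) (h 1)]
  simp only [one_div, inv_pow]
  ring

/-- `φ = q / r` on the bidisk, where the polynomials `q` and `r` have no common factor and `r` has
no zero in the bidisk. (`IsRelPrime` says that every common divisor is a unit.) -/
structure IsReducedFraction (φ : (Fin 2 → ℂ) → ℂ) (q r : MvPolynomial (Fin 2) ℂ) : Prop where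
  relPrime : IsRelPrime q r
  ne_zero : ∀ z ∈ bidisk, MvPolynomial.eval z r ≠ 0
  eq_div : ∀ z ∈ bidisk, φ z = MvPolynomial.eval z q / MvPolynomial.eval z r

/-- The rational function `φ` on the bidisk has bidegree `(n₁, n₂)`, after cancellation of all
common factors of its numerator and denominator. -/
def HasBidegree (φ : (Fin 2 → ℂ) → ℂ) (n₁ n₂ : ℕ) : Prop :=
  ∃ q r : MvPolynomial (Fin 2) ℂ, IsReducedFraction φ q r ∧
    max (q.degreeOf 0) (r.degreeOf 0) = n₁ ∧ max (q.degreeOf 1) (r.degreeOf 1) = n₂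

/-- `φ` is, on the bidisk, a rational inner function `c * p̃ / p` of bidegree `(n₁, n₂)`: `c` is a
unimodular constant, `p` is a polynomial of bidegree `(n₁, n₂)` without zeros in the bidisk, and
`p` and its reflection `p̃` have no common factor. -/
def IsRationalInner (φ : (Fin 2 → ℂ) → ℂ) (n₁ n₂ : ℕ) : Prop :=
  ∃ (c : ℂ) (p : MvPolynomial (Fin 2) ℂ), ‖c‖ = 1 ∧
    p.degreeOf 0 = n₁ ∧ p.degreeOf 1 = n₂ ∧
    (∀ z ∈ bidisk, MvPolynomial.eval z p ≠ 0) ∧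
    IsRelPrime (reflection p) p ∧
    ∀ z ∈ bidisk, φ z = c * MvPolynomial.eval z (reflection p) / MvPolynomial.eval z p

/-- The `N`-fold composition of `φ` with itself in the second variable, the first one being a
parameter. -/
def iter (φ : (Fin 2 → ℂ) → ℂ) : ℕ → (Fin 2 → ℂ) → ℂ
  | 0, z => z 1
  | N + 1, z => φ ![z 0, iter φ N z]

/-- `ζ` is a singularity of `φ` on the torus: numerator and denominator of `φ`, without common
factors, both vanish at `ζ`. -/
def IsSingularity (φ : (Fin 2 → ℂ) → ℂ) (ζ : Fin 2 → ℂ) : Prop :=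
  ζ ∈ torus ∧ ∃ q r : MvPolynomial (Fin 2) ℂ, IsReducedFraction φ q r ∧
    MvPolynomial.eval ζ q = 0 ∧ MvPolynomial.eval ζ r = 0

/-- `m` is the `z₂`-contact order of `φ` (of degree one in `z₂`) at the singularity `ζ`: with
`ζ₁ = exp (i η)` and `ψ θ` the unique zero of the numerator of `φ` on the line
`z₁ = exp (i θ)`, the quantity `1 - |ψ θ| ^ 2` is comparable to `(θ - η) ^ m` near `η`. -/
def HasContactOrder (φ : (Fin 2 → ℂ) → ℂ) (ζ : Fin 2 → ℂ) (m : ℕ) : Prop :=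
  ∃ q r : MvPolynomial (Fin 2) ℂ, IsReducedFraction φ q r ∧
    ∃ (η : ℝ) (ψ : ℝ → ℂ), ζ 0 = Complex.exp (η * Complex.I) ∧
      (∀ᶠ θ : ℝ in 𝓝 η, ∀ w : ℂ,
        MvPolynomial.eval ![Complex.exp (θ * Complex.I), w] q = 0 ↔ w = ψ θ) ∧
      (fun θ : ℝ => 1 - ‖ψ θ‖ ^ 2) =Θ[𝓝 η] (fun θ : ℝ => (θ - η) ^ m)

end BidiskRIF

end

/-! ### Polynomials of degree at most one in `z₂` -/

noncomputable section

namespace BidiskRIF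

open Polynomial (aeval)

/-! For fixed `z₁ = t`, `φ` is a Möbius map of `z₂` with a matrix `M(t)` whose entries are
polynomials of degree at most `n₁`, so `φ^N` has matrix `M(t)^N`. The iterates are defined on the
bidisk because `|φ| < 1` there (maximum principle). Full bidegree means that numerator and
denominator read off from `M^N` have no common factor; in particular `M(t)^N` is never the zero
matrix.

On `|t| = 1` one has `M J M* = δ J` with `J = diag(1, -1)` and `δ = |M₀₀|² - |M₀₁|²`. Iterating, the
corresponding quantity for `M^N` is `δ^N`.

A singularity over `t` forces `det M(t) = 0`. Then Cayley–Hamilton makes `M(t)^N` a multiple of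
`M(t)`, a nonzero one by full bidegree, so `φ` and `φ^N` have the same singularities. There `M₀₀(t)
≠ 0`, and `1 - |ψ|² = δ / |M₀₀|²` nearby, so the contact order is the order of vanishing of `δ`; it
is multiplied by `N`. -/

/-- The polynomial `A (z₁) * z₂ + B (z₁)`. -/
def linPoly (A B : Polynomial ℂ) : MvPolynomial (Fin 2) ℂ :=
  MvPolynomial.X 1 * aeval (MvPolynomial.X 0) A + aeval (MvPolynomial.X 0) B

theorem eval_aeval_X (z : Fin 2 → ℂ) (j : Fin 2) (A : Polynomial ℂ) :
    MvPolynomial.eval z (aeval (MvPolynomial.X j) A) = A.eval (z j) := by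
  have h := Polynomial.hom_eval₂ A (algebraMap ℂ (MvPolynomial (Fin 2) ℂ)) (MvPolynomial.eval z)
    (MvPolynomial.X j)
  rw [Polynomial.aeval_def, h, MvPolynomial.eval_X]
  have : (MvPolynomial.eval z).comp (algebraMap ℂ (MvPolynomial (Fin 2) ℂ)) = RingHom.id ℂ := by
    ext; simp [MvPolynomial.algebraMap_eq]
  rw [this]
  rfl

@[simp]
theorem eval_linPoly (z : Fin 2 → ℂ) (A B : Polynomial ℂ) :
    MvPolynomial.eval z (linPoly A B) = A.eval (z 0) * z 1 + B.eval (z 0) := by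
  simp only [linPoly, map_add, map_mul, MvPolynomial.eval_X, eval_aeval_X]
  ring

theorem linPoly_add (A B A' B' : Polynomial ℂ) :
    linPoly (A + A') (B + B') = linPoly A B + linPoly A' B' := by
  simp only [linPoly, map_add]
  ring

theorem degreeOf_aeval_X_le (A : Polynomial ℂ) :
    (aeval (MvPolynomial.X 0 : MvPolynomial (Fin 2) ℂ) A).degreeOf 0 ≤ A.natDegree := by
  rw [Polynomial.aeval_eq_sum_range]
  refine (MvPolynomial.degreeOf_sum_le _ _ _).trans (Finset.sup_le fun i hi => ?_)
  rw [MvPolynomial.smul_eq_C_mul]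
  refine (MvPolynomial.degreeOf_C_mul_le _ _ _).trans ?_
  rw [MvPolynomial.degreeOf_X_self_pow]
  simp only [Finset.mem_range] at hi
  omega

theorem degreeOf_one_aeval_X (A : Polynomial ℂ) :
    (aeval (MvPolynomial.X 0 : MvPolynomial (Fin 2) ℂ) A).degreeOf 1 = 0 := by
  rw [Polynomial.aeval_eq_sum_range]
  refine Nat.le_zero.1 ((MvPolynomial.degreeOf_sum_le _ _ _).trans (Finset.sup_le fun i hi => ?_))
  rw [MvPolynomial.smul_eq_C_mul]
  refine (MvPolynomial.degreeOf_C_mul_le _ _ _).trans ?_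
  rw [MvPolynomial.degreeOf_X_pow_of_ne _ (by decide)]

theorem degreeOf_zero_linPoly_le {A B : Polynomial ℂ} {n : ℕ} (hA : A.natDegree ≤ n)
    (hB : B.natDegree ≤ n) : (linPoly A B).degreeOf 0 ≤ n := by
  refine (MvPolynomial.degreeOf_add_le _ _ _).trans (max_le ?_ ((degreeOf_aeval_X_le B).trans hB))
  refine (MvPolynomial.degreeOf_mul_le _ _ _).trans ?_
  rw [MvPolynomial.degreeOf_X_of_ne (by decide), zero_add]
  exact (degreeOf_aeval_X_le A).trans hA

theorem degreeOf_one_linPoly_le (A B : Polynomial ℂ) : (linPoly A B).degreeOf 1 ≤ 1 := by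
  refine (MvPolynomial.degreeOf_add_le _ _ _).trans (max_le ?_ ?_)
  · refine (MvPolynomial.degreeOf_mul_le _ _ _).trans ?_
    rw [MvPolynomial.degreeOf_X_self, degreeOf_one_aeval_X]
  · rw [degreeOf_one_aeval_X]
    exact zero_le_one

theorem exists_monomial_eq_linPoly {n : ℕ} {m : Fin 2 →₀ ℕ} (h0 : m 0 ≤ n) (h1 : m 1 ≤ 1) (c : ℂ) :
    ∃ A B : Polynomial ℂ, A.natDegree ≤ n ∧ B.natDegree ≤ n ∧
      MvPolynomial.monomial m c = linPoly A B := by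
  have hm : MvPolynomial.monomial m c =
      MvPolynomial.C c * (MvPolynomial.X 0 ^ m 0 * MvPolynomial.X 1 ^ m 1) := by
    rw [MvPolynomial.monomial_eq, Finsupp.prod_fintype _ _ (by simp), Fin.prod_univ_two]
  have hd : (Polynomial.C c * Polynomial.X ^ m 0).natDegree ≤ n :=
    (Polynomial.natDegree_C_mul_X_pow_le _ _).trans h0
  rcases Nat.le_one_iff_eq_zero_or_eq_one.1 h1 with h | h
  · refine ⟨0, Polynomial.C c * Polynomial.X ^ m 0, by simp, hd, ?_⟩
    rw [hm, h]
    simp [linPoly, MvPolynomial.algebraMap_eq]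
  · refine ⟨Polynomial.C c * Polynomial.X ^ m 0, 0, hd, by simp, ?_⟩
    rw [hm, h]
    simp [linPoly, MvPolynomial.algebraMap_eq]
    ring

theorem exists_sum_monomial_eq_linPoly {ι : Type*} {n : ℕ} (s : Finset ι) (m : ι → Fin 2 →₀ ℕ)
    (c : ι → ℂ) (h0 : ∀ i ∈ s, m i 0 ≤ n) (h1 : ∀ i ∈ s, m i 1 ≤ 1) :
    ∃ A B : Polynomial ℂ, A.natDegree ≤ n ∧ B.natDegree ≤ n ∧
      ∑ i ∈ s, MvPolynomial.monomial (m i) (c i) = linPoly A B := by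
  classical
  induction s using Finset.induction_on with
  | empty => exact ⟨0, 0, by simp, by simp, by simp [linPoly]⟩
  | insert i s hi ih =>
    obtain ⟨A, B, hA, hB, h⟩ := ih (fun j hj => h0 j (Finset.mem_insert_of_mem hj))
      fun j hj => h1 j (Finset.mem_insert_of_mem hj)
    obtain ⟨A', B', hA', hB', h'⟩ := exists_monomial_eq_linPoly
      (h0 i (Finset.mem_insert_self i s)) (h1 i (Finset.mem_insert_self i s)) (c i)
    refine ⟨A' + A, B' + B, Polynomial.natDegree_add_le_of_degree_le hA' hA,
      Polynomial.natDegree_add_le_of_degree_le hB' hB, ?_⟩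
    rw [Finset.sum_insert hi, h, h', linPoly_add]

theorem exists_eq_linPoly {n : ℕ} {p : MvPolynomial (Fin 2) ℂ} (h0 : p.degreeOf 0 ≤ n)
    (h1 : p.degreeOf 1 ≤ 1) :
    ∃ A B : Polynomial ℂ, A.natDegree ≤ n ∧ B.natDegree ≤ n ∧ p = linPoly A B := by
  obtain ⟨A, B, hA, hB, h⟩ := exists_sum_monomial_eq_linPoly p.support (fun m => m)
    (fun m => p.coeff m) (fun m hm => (MvPolynomial.monomial_le_degreeOf 0 hm).trans h0)
    fun m hm => (MvPolynomial.monomial_le_degreeOf 1 hm).trans h1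
  exact ⟨A, B, hA, hB, by rw [← h]; exact p.as_sum⟩

theorem exists_reflection_eq_linPoly {n : ℕ} {p : MvPolynomial (Fin 2) ℂ} (h0 : p.degreeOf 0 ≤ n)
    (h1 : p.degreeOf 1 ≤ 1) :
    ∃ A B : Polynomial ℂ, A.natDegree ≤ n ∧ B.natDegree ≤ n ∧ reflection p = linPoly A B :=
  exists_sum_monomial_eq_linPoly p.support _ _ (fun _ _ => (Nat.sub_le _ _).trans h0)
    fun _ _ => (Nat.sub_le _ _).trans h1

/-! ### Uniqueness of reduced fractions -/

theorem bidisk_eq_pi : bidisk = Set.pi Set.univ fun _ => Metric.ball (0 : ℂ) 1 := by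
  ext z
  simp [bidisk]

theorem infinite_ball : (Metric.ball (0 : ℂ) 1).Infinite :=
  infinite_of_mem_nhds 0 (Metric.ball_mem_nhds 0 one_pos)

theorem infinite_sphere : (Metric.sphere (0 : ℂ) 1).Infinite := by
  refine IsPreconnected.infinite_of_nontrivial
    (isPreconnected_sphere (by simp [Complex.rank_real_complex]) 0 1) ⟨1, by simp, -1, by simp, ?_⟩
  norm_num

theorem eq_of_eval_eq_on_bidisk {p q : MvPolynomial (Fin 2) ℂ}
    (h : ∀ z ∈ bidisk, MvPolynomial.eval z p = MvPolynomial.eval z q) : p = q :=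
  MvPolynomial.funext_set (fun _ => Metric.ball (0 : ℂ) 1) (fun _ => infinite_ball)
    fun z hz => h z (bidisk_eq_pi ▸ hz)

theorem eq_zero_of_eval_sphere_eq_zero {p : Polynomial ℂ} (h : ∀ t : ℂ, ‖t‖ = 1 → p.eval t = 0) :
    p = 0 :=
  Polynomial.eq_zero_of_infinite_isRoot p
    (infinite_sphere.mono fun t ht => h t (by simpa using ht))

theorem zero_mem_bidisk : (0 : Fin 2 → ℂ) ∈ bidisk := fun j => by simp

theorem IsReducedFraction.exists_mul {φ : (Fin 2 → ℂ) → ℂ} {q r q' r' : MvPolynomial (Fin 2) ℂ}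
    (h : IsReducedFraction φ q r) (hr' : ∀ z ∈ bidisk, MvPolynomial.eval z r' ≠ 0)
    (hφ : ∀ z ∈ bidisk, φ z = MvPolynomial.eval z q' / MvPolynomial.eval z r') :
    ∃ g, q' = g * q ∧ r' = g * r := by
  have key : q' * r = q * r' := eq_of_eval_eq_on_bidisk fun z hz => by
    have := hφ z hz
    rw [h.eq_div z hz, div_eq_div_iff (h.ne_zero z hz) (hr' z hz)] at this
    rw [map_mul, map_mul, this]
  have hr : r ≠ 0 := fun h0 => h.ne_zero 0 zero_mem_bidisk (by simp [h0])
  obtain ⟨g, hg⟩ : r ∣ r' := h.relPrime.symm.dvd_of_dvd_mul_left (Dvd.intro_left q' key)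
  refine ⟨g, mul_right_cancel₀ hr ?_, by rw [hg, mul_comm]⟩
  rw [key, hg]
  ring

theorem IsReducedFraction.exists_C_mul {φ : (Fin 2 → ℂ) → ℂ} {q r q' r' : MvPolynomial (Fin 2) ℂ}
    (h : IsReducedFraction φ q r) (h' : IsReducedFraction φ q' r') :
    ∃ u : ℂ, u ≠ 0 ∧ q' = MvPolynomial.C u * q ∧ r' = MvPolynomial.C u * r := by
  obtain ⟨g, hq, hr⟩ := h.exists_mul h'.ne_zero h'.eq_div
  have hg : IsUnit g := h'.relPrime (hq ▸ dvd_mul_right g q) (hr ▸ dvd_mul_right g r)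
  obtain ⟨u, hu, rfl⟩ := MvPolynomial.isUnit_iff_eq_C_of_isReduced.1 hg
  exact ⟨u, hu.ne_zero, hq, hr⟩

/-- The reduced form already attains both degrees, so the degree bounds leave no room for a
nonconstant cofactor `g`. -/
theorem HasBidegree.isReducedFraction {φ : (Fin 2 → ℂ) → ℂ} {n₁ n₂ : ℕ} (h : HasBidegree φ n₁ n₂)
    {q r : MvPolynomial (Fin 2) ℂ} (hr : ∀ z ∈ bidisk, MvPolynomial.eval z r ≠ 0)
    (hφ : ∀ z ∈ bidisk, φ z = MvPolynomial.eval z q / MvPolynomial.eval z r)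
    (hq₁ : q.degreeOf 0 ≤ n₁) (hr₁ : r.degreeOf 0 ≤ n₁) (hq₂ : q.degreeOf 1 ≤ n₂)
    (hr₂ : r.degreeOf 1 ≤ n₂) : IsReducedFraction φ q r := by
  obtain ⟨q₀, r₀, h₀, hd₁, hd₂⟩ := h
  obtain ⟨g, rfl, rfl⟩ := h₀.exists_mul hr hφ
  have hg : g ≠ 0 := fun h0 => hr 0 zero_mem_bidisk (by simp [h0])
  have hr₀ : r₀ ≠ 0 := fun h0 => h₀.ne_zero 0 zero_mem_bidisk (by simp [h0])
  rw [MvPolynomial.degreeOf_mul_eq hg hr₀] at hr₁ hr₂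
  have hdeg : ∀ j, g.degreeOf j = 0 := by
    -- `degreeOf` of zero is `0`, so if `q₀ = 0` the degrees are attained by `r₀` alone.
    by_cases hq₀ : q₀ = 0
    · subst hq₀
      simp only [MvPolynomial.degreeOf_zero] at hd₁ hd₂
      intro j
      fin_cases j <;> simp only [Fin.zero_eta, Fin.mk_one, Fin.isValue] <;> omega
    · rw [MvPolynomial.degreeOf_mul_eq hg hq₀] at hq₁ hq₂
      intro j
      fin_cases j <;> simp only [Fin.zero_eta, Fin.mk_one, Fin.isValue] <;> omega
  obtain ⟨u, rfl⟩ : ∃ u, g = MvPolynomial.C u := by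
    refine ⟨g.coeff 0, ?_⟩
    refine MvPolynomial.vars_eq_empty_iff_eq_C.1 (Finset.eq_empty_of_forall_notMem fun j hj => ?_)
    have := hdeg j
    classical
    rw [MvPolynomial.degreeOf_def, Multiset.count_eq_zero] at this
    exact this (by simpa [MvPolynomial.vars_def] using hj)
  have hu : IsUnit (MvPolynomial.C u : MvPolynomial (Fin 2) ℂ) :=
    (IsUnit.mk0 u (by rintro rfl; simp at hg)).map MvPolynomial.C
  refine ⟨?_, hr, hφ⟩
  exact (isRelPrime_mul_unit_left hu).2 h₀.relPrime

end BidiskRIF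

end

/-! ### Boundary behaviour of `p` and the bound `|φ| < 1` -/

noncomputable section

namespace BidiskRIF

open Polynomial (aeval)

/-- Otherwise `z₁ - t` is a common factor. -/
theorem linPoly_common_zero_false {A B C D : Polynomial ℂ}
    (h : IsRelPrime (linPoly A B) (linPoly C D)) (t : ℂ) (hA : A.eval t = 0) (hB : B.eval t = 0)
    (hC : C.eval t = 0) (hD : D.eval t = 0) : False := by
  have key : ∀ P Q : Polynomial ℂ, P.eval t = 0 → Q.eval t = 0 →
      aeval (MvPolynomial.X 0 : MvPolynomial (Fin 2) ℂ) (Polynomial.X - Polynomial.C t) ∣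
        linPoly P Q := fun P Q hP hQ =>
    dvd_add (Dvd.dvd.mul_left (map_dvd _ (Polynomial.dvd_iff_isRoot.2 hP)) _)
      (map_dvd _ (Polynomial.dvd_iff_isRoot.2 hQ))
  have hu := (h (key A B hA hB) (key C D hC hD)).map (MvPolynomial.eval fun _ => t)
  rw [eval_aeval_X] at hu
  simp at hu

theorem eval_reflection_coeff {p : MvPolynomial (Fin 2) ℂ} {a b a' b' : Polynomial ℂ}
    (hp : p = linPoly b a) (hr : reflection p = linPoly a' b') (h1 : p.degreeOf 1 = 1) {t : ℂ}
    (ht : ‖t‖ = 1) :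
    a'.eval t = t ^ p.degreeOf 0 * conj (a.eval t) ∧
      b'.eval t = t ^ p.degreeOf 0 * conj (b.eval t) := by
  have ht0 : t ≠ 0 := by rintro rfl; simp at ht
  have hinv : 1 / conj t = t := by
    rw [one_div, ← Complex.inv_eq_conj ht, inv_inv]
  have key : ∀ w : ℂ, w ≠ 0 → 1 / conj w = w → a'.eval t * w + b'.eval t =
      t ^ p.degreeOf 0 * w * conj (b.eval t * w + a.eval t) := by
    intro w hw hw'
    have := eval_reflection p ![t, w] (by intro j; fin_cases j <;> simpa)
    rw [hr, h1] at this
    nth_rewrite 2 [hp] at this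
    simpa only [eval_linPoly, Matrix.cons_val_zero, Matrix.cons_val_one, hinv, hw', pow_one]
      using this
  -- Two points of the unit circle separate the two coefficients in `w`.
  have e1 := key 1 one_ne_zero (by simp)
  have e2 := key (-1) (by norm_num) (by simp)
  simp only [map_add, map_mul, map_one, map_neg] at e1 e2
  constructor
  · linear_combination (e1 - e2) / 2
  · linear_combination (e1 + e2) / 2

/-- `p = a + b z₂` has no zeros in the bidisk, and its
reflection `b' + a' z₂` has no factor in common with it. -/
structure IsStablePair (n : ℕ) (a b a' b' : Polynomial ℂ) : Prop where
  ne_zero : ∀ z ∈ bidisk, MvPolynomial.eval z (linPoly b a) ≠ 0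
  relPrime : IsRelPrime (linPoly a' b') (linPoly b a)
  fst_eq : ∀ t : ℂ, ‖t‖ = 1 → a'.eval t = t ^ n * conj (a.eval t)
  snd_eq : ∀ t : ℂ, ‖t‖ = 1 → b'.eval t = t ^ n * conj (b.eval t)

namespace IsStablePair

variable {n : ℕ} {a b a' b' : Polynomial ℂ}

/-- Inside the disk, failure would put the zero `-a/b` of `p` in the bidisk; the boundary follows by
continuity. -/
theorem norm_le_of_norm_le_one {t : ℂ} (ht : ‖t‖ ≤ 1) (h : IsStablePair n a b a' b') :
    ‖b.eval t‖ ≤ ‖a.eval t‖ := by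
  have key : ∀ x ∈ Metric.ball (0 : ℂ) 1, ‖b.eval x‖ ≤ ‖a.eval x‖ := by
    intro x hx
    by_contra! hlt
    have hb : b.eval x ≠ 0 := norm_pos_iff.1 ((norm_nonneg _).trans_lt hlt)
    refine h.ne_zero ![x, -(a.eval x / b.eval x)] ?_ ?_
    · intro j
      fin_cases j
      · simpa using hx
      · simpa [div_lt_one (norm_pos_iff.2 hb)] using hlt
    · simp [mul_div_cancel₀ _ hb]
  refine le_on_closure key b.continuous.norm.continuousOn a.continuous.norm.continuousOn ?_
  rw [closure_ball _ one_ne_zero]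
  simpa using ht

theorem fst_ne_zero {t : ℂ} (ht : ‖t‖ = 1) (h : IsStablePair n a b a' b') : a.eval t ≠ 0 := by
  intro ha
  have hb : b.eval t = 0 := by
    simpa [ha] using h.norm_le_of_norm_le_one ht.le
  exact linPoly_common_zero_false h.relPrime t (by simp [h.fst_eq t ht, ha])
    (by simp [h.snd_eq t ht, hb]) hb ha

theorem denominator_ne_zero {t w : ℂ} (ht : ‖t‖ ≤ 1) (hw : ‖w‖ < 1)
    (h : IsStablePair n a b a' b') : b.eval t * w + a.eval t ≠ 0 := by
  rcases ht.lt_or_eq with ht | ht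
  · simpa using h.ne_zero ![t, w] (by intro j; fin_cases j <;> simpa)
  · intro h0
    have ha := norm_pos_iff.2 (h.fst_ne_zero ht)
    have h1 : ‖a.eval t‖ = ‖b.eval t‖ * ‖w‖ := by
      rw [← norm_mul, ← norm_neg, eq_neg_of_add_eq_zero_right h0, neg_neg]
    have h2 := h.norm_le_of_norm_le_one ht.le
    nlinarith [norm_nonneg w]

/-- The difference of the squared moduli of denominator and numerator on `𝕋 × ℂ`. -/
theorem norm_sq_sub_norm_sq {t : ℂ} (ht : ‖t‖ = 1) (w : ℂ) (h : IsStablePair n a b a' b') :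
    ‖b.eval t * w + a.eval t‖ ^ 2 - ‖a'.eval t * w + b'.eval t‖ ^ 2 =
      (‖a.eval t‖ ^ 2 - ‖b.eval t‖ ^ 2) * (1 - ‖w‖ ^ 2) := by
  have e : a'.eval t * w + b'.eval t = t ^ n * (conj (a.eval t) * w + conj (b.eval t)) := by
    rw [h.fst_eq t ht, h.snd_eq t ht]
    ring
  rw [e, norm_mul, norm_pow, ht, one_pow, one_mul, ← Complex.ofReal_inj]
  push_cast
  simp only [← Complex.mul_conj', map_add, map_mul, Complex.conj_conj]
  ring

/-- If `|a| = |b|` on the whole circle, then `a'a = b'b` identically, so `p` divides `p̃ b` and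
hence `b(z₁)`. But `p` vanishes somewhere on the line `z₁ = 1`, where `b` does not. -/
theorem exists_norm_lt (h : IsStablePair n a b a' b') :
    ∃ t : ℂ, ‖t‖ = 1 ∧ ‖b.eval t‖ < ‖a.eval t‖ := by
  by_contra! hle
  have hdet : a' * a - b' * b = 0 := by
    refine eq_zero_of_eval_sphere_eq_zero fun t ht => ?_
    have heq := le_antisymm (h.norm_le_of_norm_le_one ht.le) (hle t ht)
    rw [Polynomial.eval_sub, Polynomial.eval_mul, Polynomial.eval_mul, h.fst_eq t ht,
      h.snd_eq t ht, mul_assoc, mul_assoc, Complex.conj_mul', Complex.conj_mul', heq, sub_self]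
  have hdvd : linPoly b a ∣ aeval (MvPolynomial.X 0) b := by
    refine h.relPrime.symm.dvd_of_dvd_mul_left
      ⟨aeval (MvPolynomial.X 0) a', ?_⟩
    have := congrArg (aeval (MvPolynomial.X 0 : MvPolynomial (Fin 2) ℂ)) hdet
    simp only [map_sub, map_mul, map_zero] at this
    simp only [linPoly]
    linear_combination -this
  have ha := h.fst_ne_zero norm_one
  have hb : b.eval 1 ≠ 0 :=
    norm_pos_iff.1 ((norm_pos_iff.2 ha).trans_le (hle 1 norm_one))
  obtain ⟨g, hg⟩ := hdvd
  have := congrArg (MvPolynomial.eval ![1, -(a.eval 1 / b.eval 1)]) hg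
  rw [eval_aeval_X, map_mul] at this
  exact hb (by simpa [mul_div_cancel₀ _ hb] using this)

/-- Maximum principle in `z₁` for fixed `z₂`: the quotient has modulus at most `1` on the circle,
and less than `1` at the point given by `exists_norm_lt`. -/
theorem norm_numerator_lt {z : Fin 2 → ℂ} (hz : z ∈ bidisk) (h : IsStablePair n a b a' b') :
    ‖MvPolynomial.eval z (linPoly a' b')‖ < ‖MvPolynomial.eval z (linPoly b a)‖ := by
  set w := z 1 with hw
  have hw1 : ‖w‖ < 1 := hz 1
  have hz0 : z 0 ∈ Metric.ball (0 : ℂ) 1 := by simpa using hz 0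
  set f : ℂ → ℂ := fun t => (a'.eval t * w + b'.eval t) / (b.eval t * w + a.eval t) with hf
  have hne : ∀ t ∈ Metric.closedBall (0 : ℂ) 1, b.eval t * w + a.eval t ≠ 0 := fun t ht =>
    h.denominator_ne_zero (by simpa using ht) hw1
  have hd : DiffContOnCl ℂ f (Metric.ball 0 1) := by
    refine DifferentiableOn.diffContOnCl ?_
    rw [closure_ball _ one_ne_zero]
    intro t ht
    refine DifferentiableAt.differentiableWithinAt (DifferentiableAt.div ?_ ?_ (hne t ht))
    · exact (a'.differentiableAt.mul_const w).add b'.differentiableAt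
    · exact (b.differentiableAt.mul_const w).add a.differentiableAt
  have hw2 : 0 < 1 - ‖w‖ ^ 2 := by nlinarith [norm_nonneg w]
  have hle : ∀ t ∈ Metric.ball (0 : ℂ) 1, ‖f t‖ ≤ 1 := by
    intro t ht
    refine Complex.norm_le_of_forall_mem_frontier_norm_le Metric.isBounded_ball hd ?_
      (subset_closure ht)
    intro x hx
    rw [frontier_ball _ one_ne_zero] at hx
    have hx1 : ‖x‖ = 1 := by simpa using hx
    have := h.norm_sq_sub_norm_sq hx1 w
    have h3 := h.norm_le_of_norm_le_one hx1.le
    rw [hf, norm_div]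
    refine div_le_one_of_le₀ (abs_le_of_sq_le_sq' ?_ (norm_nonneg _)).2 (norm_nonneg _)
    have : 0 ≤ (‖a.eval x‖ ^ 2 - ‖b.eval x‖ ^ 2) * (1 - ‖w‖ ^ 2) :=
      mul_nonneg (sub_nonneg.2 (pow_le_pow_left₀ (norm_nonneg _) h3 2)) hw2.le
    linarith
  have hlt : ‖f (z 0)‖ < 1 := by
    refine lt_of_le_of_ne (hle _ hz0) fun h1 => ?_
    obtain ⟨t, ht, htlt⟩ := h.exists_norm_lt
    have hmax : IsMaxOn (norm ∘ f) (Metric.ball 0 1) (z 0) := fun x hx => by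
      simpa [h1] using hle x hx
    have heq := Complex.eqOn_closure_of_isPreconnected_of_isMaxOn_norm
      (convex_ball (0 : ℂ) 1).isPreconnected Metric.isOpen_ball hd hz0 hmax
    have htc : t ∈ closure (Metric.ball (0 : ℂ) 1) := by
      rw [closure_ball _ one_ne_zero]
      simp [ht]
    have h4 : ‖f t‖ = 1 := by rw [heq htc, ← h1, Function.const_apply]
    have hpos := norm_pos_iff.2 (hne t (by simp [ht]))
    rw [hf, norm_div, div_eq_one_iff_eq hpos.ne'] at h4
    have h5 := h.norm_sq_sub_norm_sq ht w
    rw [h4, sub_self] at h5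
    have : 0 < (‖a.eval t‖ ^ 2 - ‖b.eval t‖ ^ 2) * (1 - ‖w‖ ^ 2) :=
      mul_pos (sub_pos.2 (pow_lt_pow_left₀ htlt (norm_nonneg _) two_ne_zero)) hw2
    linarith
  rw [hf, norm_div, div_lt_one (norm_pos_iff.2 (hne _ (Metric.ball_subset_closedBall hz0)))] at hlt
  simpa using hlt

end IsStablePair

end BidiskRIF

end

/-! ### Möbius matrices and their powers -/

noncomputable section

namespace BidiskRIF

/-- The value at `t` of a matrix of polynomials. -/
def matEval (t : ℂ) (M : Matrix (Fin 2) (Fin 2) (Polynomial ℂ)) : Matrix (Fin 2) (Fin 2) ℂ :=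
  (Polynomial.evalRingHom t).mapMatrix M

@[simp]
theorem matEval_apply (t : ℂ) (M : Matrix (Fin 2) (Fin 2) (Polynomial ℂ)) (i j : Fin 2) :
    matEval t M i j = (M i j).eval t := rfl

theorem matEval_pow (t : ℂ) (M : Matrix (Fin 2) (Fin 2) (Polynomial ℂ)) (N : ℕ) :
    matEval t (M ^ N) = matEval t M ^ N := map_pow _ _ _

/-- The numerator of the Möbius transformation in `z₂` with matrix `M (z₁)`. -/
def moebNum (M : Matrix (Fin 2) (Fin 2) (Polynomial ℂ)) : MvPolynomial (Fin 2) ℂ :=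
  linPoly (M 0 0) (M 0 1)

/-- The denominator of the Möbius transformation in `z₂` with matrix `M (z₁)`. -/
def moebDen (M : Matrix (Fin 2) (Fin 2) (Polynomial ℂ)) : MvPolynomial (Fin 2) ℂ :=
  linPoly (M 1 0) (M 1 1)

theorem eval_moebNum (M : Matrix (Fin 2) (Fin 2) (Polynomial ℂ)) (z : Fin 2 → ℂ) :
    MvPolynomial.eval z (moebNum M) = matEval (z 0) M 0 0 * z 1 + matEval (z 0) M 0 1 :=
  eval_linPoly _ _ _

theorem eval_moebDen (M : Matrix (Fin 2) (Fin 2) (Polynomial ℂ)) (z : Fin 2 → ℂ) :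
    MvPolynomial.eval z (moebDen M) = matEval (z 0) M 1 0 * z 1 + matEval (z 0) M 1 1 :=
  eval_linPoly _ _ _

/-- The signature matrix of the unit disk. -/
def sigMat : Matrix (Fin 2) (Fin 2) ℂ := !![1, 0; 0, -1]

/-- The Möbius transformations with matrix `M (z₁)` represent the rational inner function `φ`. -/
structure IsTransferMatrix (φ : (Fin 2 → ℂ) → ℂ) (n : ℕ)
    (M : Matrix (Fin 2) (Fin 2) (Polynomial ℂ)) : Prop where
  natDegree_le : ∀ i j, (M i j).natDegree ≤ n
  isReducedFraction : IsReducedFraction φ (moebNum M) (moebDen M)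
  norm_diag : ∀ t, ‖t‖ = 1 → ‖matEval t M 0 0‖ = ‖matEval t M 1 1‖
  norm_offDiag : ∀ t, ‖t‖ = 1 → ‖matEval t M 0 1‖ = ‖matEval t M 1 0‖
  mul_sigMat_mul : ∀ t, ‖t‖ = 1 → matEval t M * sigMat * (matEval t M).conjTranspose =
    ((‖matEval t M 0 0‖ ^ 2 - ‖matEval t M 0 1‖ ^ 2 : ℝ) : ℂ) • sigMat
  norm_lt_one : ∀ z ∈ bidisk, ‖φ z‖ < 1

theorem IsRationalInner.exists_isTransferMatrix {φ : (Fin 2 → ℂ) → ℂ} {n : ℕ}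
    (hφ : IsRationalInner φ n 1) : ∃ M, IsTransferMatrix φ n M := by
  obtain ⟨c, p, hc, h0, h1, hne, hrel, heq⟩ := hφ
  obtain ⟨b, a, hb, ha, hp⟩ := exists_eq_linPoly h0.le h1.le
  obtain ⟨a', b', ha', hb', hr⟩ := exists_reflection_eq_linPoly h0.le h1.le
  have hst : IsStablePair n a b a' b' := ⟨by rwa [← hp], by rwa [← hp, ← hr],
    fun t ht => h0 ▸ (eval_reflection_coeff hp hr h1 ht).1,
    fun t ht => h0 ▸ (eval_reflection_coeff hp hr h1 ht).2⟩
  have hcu : IsUnit (MvPolynomial.C c : MvPolynomial (Fin 2) ℂ) :=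
    (IsUnit.mk0 c (by rintro rfl; simp at hc)).map MvPolynomial.C
  have hlin : linPoly (Polynomial.C c * a') (Polynomial.C c * b') =
      MvPolynomial.C c * linPoly a' b' := by
    simp only [linPoly, map_mul, Polynomial.aeval_C, MvPolynomial.algebraMap_eq]
    ring
  have hcc : c * conj c = 1 := by rw [Complex.mul_conj', hc]; simp
  refine ⟨!![Polynomial.C c * a', Polynomial.C c * b'; b, a], ?_, ?_, ?_, ?_, ?_, ?_⟩
  · intro i j
    fin_cases i <;> fin_cases j
    · exact (Polynomial.natDegree_C_mul_le _ _).trans ha'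
    · exact (Polynomial.natDegree_C_mul_le _ _).trans hb'
    · exact hb
    · exact ha
  · refine ⟨?_, ?_, ?_⟩
    · change IsRelPrime (linPoly (Polynomial.C c * a') (Polynomial.C c * b')) (linPoly b a)
      rw [hlin]
      exact (isRelPrime_mul_unit_left_left hcu).2 hst.relPrime
    · exact hst.ne_zero
    · intro z hz
      change φ z = MvPolynomial.eval z (linPoly (Polynomial.C c * a') (Polynomial.C c * b')) /
        MvPolynomial.eval z (linPoly b a)
      rw [hlin, map_mul, MvPolynomial.eval_C, ← hp, ← hr, heq z hz]
  · intro t ht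
    simp [hst.fst_eq t ht, hc, ht]
  · intro t ht
    simp [hst.snd_eq t ht, hc, ht]
  · intro t ht
    have htt : t ^ n * conj t ^ n = 1 := by
      rw [← mul_pow, Complex.mul_conj', ht]
      simp
    ext i j
    fin_cases i <;> fin_cases j <;>
      simp [sigMat, Matrix.mul_apply, Fin.sum_univ_two, hst.fst_eq t ht, hst.snd_eq t ht, hc, ht,
        ← Complex.mul_conj']
    · linear_combination (a.eval t * conj (a.eval t) - b.eval t * conj (b.eval t)) *
        (c * conj c * htt + hcc)
    · ring
    · ring
    · ring
  · intro z hz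
    have := hst.norm_numerator_lt hz
    rw [heq z hz, hr, hp, norm_div, norm_mul, hc, one_mul,
      div_lt_one ((norm_nonneg _).trans_lt this)]
    exact this

namespace IsTransferMatrix

variable {φ : (Fin 2 → ℂ) → ℂ} {n : ℕ} {M : Matrix (Fin 2) (Fin 2) (Polynomial ℂ)}

theorem natDegree_pow_le (h : IsTransferMatrix φ n M) (N : ℕ) (i j : Fin 2) :
    ((M ^ N) i j).natDegree ≤ N * n := by
  induction N generalizing i j with
  | zero =>
    rw [pow_zero, Matrix.one_apply]
    split_ifs <;> simp
  | succ N ih =>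
    rw [pow_succ, Matrix.mul_apply, Nat.succ_mul]
    exact Polynomial.natDegree_sum_le_of_forall_le _ _ fun k _ =>
      Polynomial.natDegree_mul_le_of_le (ih i k) (h.natDegree_le k j)

theorem iter_spec (h : IsTransferMatrix φ n M) (N : ℕ) {z : Fin 2 → ℂ} (hz : z ∈ bidisk) :
    ‖iter φ N z‖ < 1 ∧ MvPolynomial.eval z (moebDen (M ^ N)) ≠ 0 ∧
      MvPolynomial.eval z (moebNum (M ^ N)) =
        iter φ N z * MvPolynomial.eval z (moebDen (M ^ N)) := by
  induction N with
  | zero => simpa [eval_moebNum, eval_moebDen, iter] using hz 1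
  | succ N ih =>
    obtain ⟨h1, h2, h3⟩ := ih
    have hw : ![z 0, iter φ N z] ∈ bidisk := by
      intro j
      fin_cases j
      · exact hz 0
      · exact h1
    have hne := h.isReducedFraction.ne_zero _ hw
    have heq := h.isReducedFraction.eq_div _ hw
    rw [eq_div_iff hne] at heq
    rw [eval_moebNum, eval_moebDen] at heq h3
    rw [eval_moebDen] at hne h2 ⊢
    rw [eval_moebNum]
    simp only [matEval_pow] at h2 h3 ⊢
    simp only [Matrix.cons_val_zero, Matrix.cons_val_one] at heq hne
    refine ⟨h.norm_lt_one _ hw, ?_, ?_⟩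
    · rw [pow_succ']
      simp only [Matrix.mul_apply, Fin.sum_univ_two]
      -- The new denominator is that of `M` at `(z₁, φ^N(z))` times that of `M ^ N` at `z`.
      have := mul_ne_zero hne h2
      refine fun h0 => this ?_
      linear_combination h0 - matEval (z 0) M 1 0 * h3
    · rw [pow_succ']
      simp only [Matrix.mul_apply, Fin.sum_univ_two]
      change _ = φ ![z 0, iter φ N z] * _
      linear_combination (matEval (z 0) M 0 0 - φ ![z 0, iter φ N z] * matEval (z 0) M 1 0) * h3 -
        ((matEval (z 0) M ^ N) 1 0 * z 1 + (matEval (z 0) M ^ N) 1 1) * heq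

/-- Full bidegree enters here: it excludes cancellation in the entries of `M ^ N`. -/
theorem isReducedFraction_iter (h : IsTransferMatrix φ n M) {N : ℕ}
    (hfull : HasBidegree (iter φ N) (N * n) 1) :
    IsReducedFraction (iter φ N) (moebNum (M ^ N)) (moebDen (M ^ N)) :=
  hfull.isReducedFraction (fun _ hz => (h.iter_spec N hz).2.1)
    (fun _ hz => eq_div_of_mul_eq (h.iter_spec N hz).2.1 (h.iter_spec N hz).2.2.symm)
    (degreeOf_zero_linPoly_le (h.natDegree_pow_le N _ _) (h.natDegree_pow_le N _ _))
    (degreeOf_zero_linPoly_le (h.natDegree_pow_le N _ _) (h.natDegree_pow_le N _ _))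
    (degreeOf_one_linPoly_le _ _) (degreeOf_one_linPoly_le _ _)

end IsTransferMatrix

end BidiskRIF

end

/-! ### Singularities and contact orders of the iterates -/

noncomputable section

namespace BidiskRIF

theorem IsReducedFraction.isSingularity_iff {φ : (Fin 2 → ℂ) → ℂ} {q r : MvPolynomial (Fin 2) ℂ}
    (h : IsReducedFraction φ q r) {ξ : Fin 2 → ℂ} :
    IsSingularity φ ξ ↔ ξ ∈ torus ∧ MvPolynomial.eval ξ q = 0 ∧ MvPolynomial.eval ξ r = 0 := by
  refine and_congr_right fun _ => ⟨?_, fun h' => ⟨q, r, h, h'⟩⟩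
  rintro ⟨q', r', h', hq', hr'⟩
  obtain ⟨u, -, rfl, rfl⟩ := h'.exists_C_mul h
  simp [hq', hr']

/-- For a function of degree one in `z₂` with reduced numerator `A z₂ + B`, the contact order is
the order of vanishing of `|A| ^ 2 - |B| ^ 2`. -/
theorem IsReducedFraction.hasContactOrder_iff {φ : (Fin 2 → ℂ) → ℂ} {A B : Polynomial ℂ}
    {r : MvPolynomial (Fin 2) ℂ} (h : IsReducedFraction φ (linPoly A B) r) {ζ : Fin 2 → ℂ} {m : ℕ}
    (hA : A.eval (ζ 0) ≠ 0) :
    HasContactOrder φ ζ m ↔ ∃ η : ℝ, ζ 0 = Complex.exp (η * Complex.I) ∧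
      (fun θ : ℝ => ‖A.eval (Complex.exp (θ * Complex.I))‖ ^ 2 -
        ‖B.eval (Complex.exp (θ * Complex.I))‖ ^ 2) =Θ[𝓝 η] fun θ : ℝ => (θ - η) ^ m := by
  have hzero : ∀ t w : ℂ, A.eval t ≠ 0 →
      (MvPolynomial.eval ![t, w] (linPoly A B) = 0 ↔ w = -B.eval t / A.eval t) := by
    intro t w ht
    rw [eq_div_iff ht, eq_neg_iff_add_eq_zero, eval_linPoly, mul_comm w]
    rfl
  have hcont : Continuous fun θ : ℝ => A.eval (Complex.exp (θ * Complex.I)) := by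
    exact A.continuous.comp (by fun_prop)
  have hev : ∀ η : ℝ, ζ 0 = Complex.exp (η * Complex.I) →
      ∀ᶠ θ : ℝ in 𝓝 η, A.eval (Complex.exp (θ * Complex.I)) ≠ 0 := fun η hη =>
    hcont.continuousAt.eventually_ne (by rwa [← hη])
  have hTheta : ∀ (η : ℝ) (ψ : ℝ → ℂ), ζ 0 = Complex.exp (η * Complex.I) →
      (∀ᶠ θ : ℝ in 𝓝 η, ψ θ = -B.eval (Complex.exp (θ * Complex.I)) /
        A.eval (Complex.exp (θ * Complex.I))) →
      (fun θ : ℝ => ‖A.eval (Complex.exp (θ * Complex.I))‖ ^ 2 -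
        ‖B.eval (Complex.exp (θ * Complex.I))‖ ^ 2) =Θ[𝓝 η] fun θ : ℝ => 1 - ‖ψ θ‖ ^ 2 := by
    intro η ψ hη hψ
    -- Since `A` is nonzero at `ζ 0`, the factor `|A|²` does not affect orders of vanishing.
    have h1 : (fun θ : ℝ => ‖A.eval (Complex.exp (θ * Complex.I))‖ ^ 2) =Θ[𝓝 η]
        fun _ => (1 : ℝ) := by
      have hne : ‖A.eval (Complex.exp (η * Complex.I))‖ ^ 2 ≠ 0 := by
        rw [← hη]
        exact pow_ne_zero _ (norm_ne_zero_iff.2 hA)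
      exact ((isEquivalent_const_iff_tendsto hne).2 (hcont.norm.pow 2).continuousAt).isTheta.trans
        (isTheta_const_const hne one_ne_zero)
    have h2 := h1.mul (isTheta_refl (fun θ : ℝ => 1 - ‖ψ θ‖ ^ 2) (𝓝 η))
    simp only [one_mul] at h2
    refine EventuallyEq.trans_isTheta ?_ h2
    filter_upwards [hψ, hev η hη] with θ hθ hne
    have := norm_ne_zero_iff.2 hne
    rw [hθ, norm_div, norm_neg]
    field_simp
  constructor
  · rintro ⟨q', r', h', η, ψ, hη, hψ, hΘ⟩
    obtain ⟨u, hu, hq, -⟩ := h.exists_C_mul h'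
    refine ⟨η, hη, (hTheta η ψ hη ?_).trans hΘ⟩
    filter_upwards [hψ, hev η hη] with θ hθ hne
    rw [← hzero _ _ hne]
    have := (hθ (ψ θ)).2 rfl
    rw [hq, map_mul, MvPolynomial.eval_C] at this
    exact (mul_eq_zero.1 this).resolve_left hu
  · rintro ⟨η, hη, hΘ⟩
    refine ⟨_, r, h, η, fun θ => -B.eval (Complex.exp (θ * Complex.I)) /
      A.eval (Complex.exp (θ * Complex.I)), hη, ?_, (hTheta η _ hη ?_).symm.trans hΘ⟩
    · filter_upwards [hev η hη] with θ hne w using hzero _ _ hne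
    · exact Eventually.of_forall fun _ => rfl

theorem pow_mul_sigMat_mul {E : Matrix (Fin 2) (Fin 2) ℂ} {δ : ℂ}
    (h : E * sigMat * E.conjTranspose = δ • sigMat) (N : ℕ) :
    E ^ N * sigMat * (E ^ N).conjTranspose = δ ^ N • sigMat := by
  induction N with
  | zero => simp
  | succ N ih =>
    calc E ^ (N + 1) * sigMat * (E ^ (N + 1)).conjTranspose
        = E ^ N * (E * sigMat * E.conjTranspose) * (E ^ N).conjTranspose := by
          rw [pow_succ, Matrix.conjTranspose_mul]
          simp only [Matrix.mul_assoc]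
      _ = δ ^ (N + 1) • sigMat := by
          rw [h, Matrix.mul_smul, Matrix.smul_mul, ih, smul_smul, pow_succ']

theorem norm_sq_sub_of_mul_sigMat_mul {E : Matrix (Fin 2) (Fin 2) ℂ} {δ : ℂ}
    (h : E * sigMat * E.conjTranspose = δ • sigMat) :
    ((‖E 0 0‖ ^ 2 - ‖E 0 1‖ ^ 2 : ℝ) : ℂ) = δ := by
  have := congrFun (congrFun h 0) 0
  simp [sigMat, Matrix.mul_apply, Fin.sum_univ_two, Complex.mul_conj'] at this
  push_cast
  linear_combination this

/-- Cayley–Hamilton reduces to `E² = (tr E) E` when the determinant vanishes. -/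
theorem pow_succ_of_det_eq_zero {R : Type*} [CommRing R] {E : Matrix (Fin 2) (Fin 2) R}
    (h : E.det = 0) (N : ℕ) : E ^ (N + 1) = E.trace ^ N • E := by
  have hsq : E * E = E.trace • E := by
    rw [Matrix.det_fin_two] at h
    ext i j
    fin_cases i <;> fin_cases j <;>
      simp [Matrix.mul_apply, Fin.sum_univ_two, Matrix.trace_fin_two]
    · linear_combination -h
    · ring
    · ring
    · linear_combination -h
  induction N with
  | zero => simp
  | succ N ih => rw [pow_succ, ih, Matrix.smul_mul, hsq, smul_smul, pow_succ]

theorem det_eq_zero_of_common_zero {R : Type*} [CommRing R] {E : Matrix (Fin 2) (Fin 2) R} {w : R}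
    (h0 : E 0 0 * w + E 0 1 = 0) (h1 : E 1 0 * w + E 1 1 = 0) : E.det = 0 := by
  rw [Matrix.det_fin_two]
  linear_combination E 0 0 * h1 - E 1 0 * h0

theorem matEval_ne_zero_of_isReducedFraction {φ : (Fin 2 → ℂ) → ℂ}
    {M : Matrix (Fin 2) (Fin 2) (Polynomial ℂ)}
    (h : IsReducedFraction φ (moebNum M) (moebDen M)) (t : ℂ) : matEval t M ≠ 0 := fun h0 =>
  linPoly_common_zero_false h.relPrime t (congrFun (congrFun h0 0) 0) (congrFun (congrFun h0 0) 1)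
    (congrFun (congrFun h0 1) 0) (congrFun (congrFun h0 1) 1)

namespace IsTransferMatrix

variable {φ : (Fin 2 → ℂ) → ℂ} {n N : ℕ} {M : Matrix (Fin 2) (Fin 2) (Polynomial ℂ)}

theorem norm_sq_sub_pow (h : IsTransferMatrix φ n M) {t : ℂ} (ht : ‖t‖ = 1) (N : ℕ) :
    ‖((M ^ N) 0 0).eval t‖ ^ 2 - ‖((M ^ N) 0 1).eval t‖ ^ 2 =
      (‖(M 0 0).eval t‖ ^ 2 - ‖(M 0 1).eval t‖ ^ 2) ^ N := by
  have := norm_sq_sub_of_mul_sigMat_mul (pow_mul_sigMat_mul (h.mul_sigMat_mul t ht) N)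
  rw [← matEval_pow] at this
  exact_mod_cast this

/-- Determinants in `M J M* = δ J` give `0 = -δ²`. -/
theorem norm_eq_of_det_eq_zero (h : IsTransferMatrix φ n M) {t : ℂ} (ht : ‖t‖ = 1)
    (hdet : (matEval t M).det = 0) : ‖matEval t M 0 0‖ = ‖matEval t M 0 1‖ := by
  have := congrArg Matrix.det (h.mul_sigMat_mul t ht)
  rw [Matrix.det_mul, Matrix.det_mul, hdet, zero_mul, zero_mul, Matrix.det_smul] at this
  simp only [sigMat, Matrix.det_fin_two_of, Fintype.card_fin] at this
  have h0 : ‖matEval t M 0 0‖ ^ 2 - ‖matEval t M 0 1‖ ^ 2 = 0 := by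
    rw [← Complex.ofReal_eq_zero]
    simpa [-matEval_apply] using this.symm
  exact (pow_left_inj₀ (norm_nonneg _) (norm_nonneg _) two_ne_zero).1 (sub_eq_zero.1 h0)

/-- All four entries have the same modulus here, and they cannot all vanish. -/
theorem apply_zero_zero_ne_zero (h : IsTransferMatrix φ n M) {t : ℂ} (ht : ‖t‖ = 1)
    (hdet : (matEval t M).det = 0) : matEval t M 0 0 ≠ 0 := by
  intro h00
  have h01 := h.norm_eq_of_det_eq_zero ht hdet
  have h11 := h.norm_diag t ht
  have h10 := h.norm_offDiag t ht
  rw [← h01, h00, norm_zero, eq_comm, norm_eq_zero] at h10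
  rw [h00, norm_zero, eq_comm, norm_eq_zero] at h11 h01
  refine matEval_ne_zero_of_isReducedFraction h.isReducedFraction t (Matrix.ext fun i j => ?_)
  fin_cases i <;> fin_cases j <;> assumption

theorem pow_eq_smul (h : IsTransferMatrix φ n M) (hN : 1 ≤ N)
    (hfull : HasBidegree (iter φ N) (N * n) 1) {t : ℂ} (hdet : (matEval t M).det = 0) :
    ∃ c : ℂ, c ≠ 0 ∧ matEval t (M ^ N) = c • matEval t M := by
  obtain ⟨k, rfl⟩ := Nat.exists_eq_add_of_le' hN
  have hp := pow_succ_of_det_eq_zero hdet k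
  rw [← matEval_pow] at hp
  refine ⟨_, fun h0 => ?_, hp⟩
  rw [h0, zero_smul] at hp
  exact matEval_ne_zero_of_isReducedFraction (h.isReducedFraction_iter hfull) t hp

theorem isSingularity_iter_iff (h : IsTransferMatrix φ n M) (hN : 1 ≤ N)
    (hfull : HasBidegree (iter φ N) (N * n) 1) (ξ : Fin 2 → ℂ) :
    IsSingularity (iter φ N) ξ ↔ IsSingularity φ ξ := by
  rw [(h.isReducedFraction_iter hfull).isSingularity_iff, h.isReducedFraction.isSingularity_iff]
  simp only [eval_moebNum, eval_moebDen]
  refine and_congr_right fun _ => ?_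
  -- Singular matrix: the two pairs of equations are proportional. Invertible matrix: neither `M`
  -- nor `M ^ N` kills a vector `(w, 1)`.
  by_cases hdet : (matEval (ξ 0) M).det = 0
  · obtain ⟨c, hc, hp⟩ := h.pow_eq_smul hN hfull hdet
    simp [-matEval_apply, hp, mul_assoc, ← mul_add, hc]
  · refine iff_of_false (fun h' => hdet ?_) fun h' => hdet (det_eq_zero_of_common_zero h'.1 h'.2)
    have := det_eq_zero_of_common_zero h'.1 h'.2
    rw [matEval_pow, Matrix.det_pow] at this
    exact eq_zero_of_pow_eq_zero this

theorem hasContactOrder_iter (h : IsTransferMatrix φ n M) (hN : 1 ≤ N)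
    (hfull : HasBidegree (iter φ N) (N * n) 1) {ξ : Fin 2 → ℂ} (hξ : IsSingularity φ ξ) {K : ℕ}
    (hK : HasContactOrder φ ξ K) : HasContactOrder (iter φ N) ξ (K * N) := by
  obtain ⟨hT, h1, h2⟩ := h.isReducedFraction.isSingularity_iff.1 hξ
  rw [eval_moebNum] at h1
  rw [eval_moebDen] at h2
  have hdet := det_eq_zero_of_common_zero h1 h2
  have h00 := h.apply_zero_zero_ne_zero (hT 0) hdet
  obtain ⟨c, hc, hp⟩ := h.pow_eq_smul hN hfull hdet
  have h00N : matEval (ξ 0) (M ^ N) 0 0 ≠ 0 := by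
    rw [hp]
    exact mul_ne_zero hc h00
  obtain ⟨η, hη, hΘ⟩ := (h.isReducedFraction.hasContactOrder_iff h00).1 hK
  refine ((h.isReducedFraction_iter hfull).hasContactOrder_iff h00N).2 ⟨η, hη, ?_⟩
  simp only [h.norm_sq_sub_pow (Complex.norm_exp_ofReal_mul_I _), pow_mul]
  exact hΘ.pow N

end IsTransferMatrix

end BidiskRIF

end

theorem mainTheorem4 (n₁ N s : ℕ) (hN : 1 ≤ N) (φ : (Fin 2 → ℂ) → ℂ)
    (hφ : BidiskRIF.IsRationalInner φ n₁ 1)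
    (ζ : Fin s → Fin 2 → ℂ) (hζ : Function.Injective ζ)
    (hsing : {ξ | BidiskRIF.IsSingularity φ ξ} = Set.range ζ)
    (K : Fin s → ℕ) (hK : ∀ i, BidiskRIF.HasContactOrder φ (ζ i) (2 * K i))
    (hfull : BidiskRIF.HasBidegree (BidiskRIF.iter φ N) (N * n₁) 1) :
    {ξ | BidiskRIF.IsSingularity (BidiskRIF.iter φ N) ξ} = Set.range ζ ∧
      ∀ i, BidiskRIF.HasContactOrder (BidiskRIF.iter φ N) (ζ i) (2 * N * K i) := by
  obtain ⟨M, hM⟩ := hφ.exists_isTransferMatrix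
  refine ⟨?_, fun i => ?_⟩
  · rw [← hsing]
    exact Set.ext fun ξ => hM.isSingularity_iter_iff hN hfull ξ
  · have hi : BidiskRIF.IsSingularity φ (ζ i) := by
      have : ζ i ∈ {ξ | BidiskRIF.IsSingularity φ ξ} := hsing ▸ Set.mem_range_self i
      exact this
    rw [mul_right_comm]
    exact hM.hasContactOrder_iter hN hfull hi (hK i)
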